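/- Let $f\colon\mathbb R^n\to\mathbb R$ and $F\colon\mathbb R^n\to\mathbb R^m$ be twice continuously differentiable, let $D_1,\dots,D_r\subset\mathbb R^m$ be polyhedral sets (each an intersection of finitely many closed half-spaces), $D:=\bigcup_{i=1}^r D_i$, and consider the mathematical program with disjunctive constraints $$\min f(x)\quad\text{subject to}\quad F(x)\in D,\tag{MPDC}$$ with feasible set $X:=\{x\in\mathbb R^n: F(x)\in D\}$. For $A\subset\mathbb R^m$ and $y\in A$ let $$\mathcal T_A(y):=\{v:\ \exists\, t_k>0,\ t_k\to0,\ v_k\to v\ \text{with}\ y+t_kv_k\in A\ \text{for all } k\}$$ be the (Bouligand) tangent cone and $\widehat{\mathcal N}_A(y):=\{\eta:\ \eta\cdot v\le 0\ \text{for all } v\in\mathcal T_A(y)\}$ the Fréchet normal cone. For $\bar x\in X$ put $I(\bar x):=\{i: F(\bar x)\in D_i\}$, let $$L(x,\lambda):=f(x)+F(x)\cdot\lambda$$ be the Lagrangian, and let $$S(\bar x):=\Big\{\lambda\in\bigcap_{i\in I(\bar x)}\widehat{\mathcal N}_{D_i}(F(\bar x)):\ \nabla_xL(\bar x,\lambda)=0\Big\}$$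 be the set of multipliers solving the S-stationarity (strong stationarity) system at $\bar x$. Let $$\mathcal L_X(\bar x):=\{d\in\mathbb R^n:\nabla F(\bar x)d\in\mathcal T_D(F(\bar x))\},\qquad \mathcal C_X(\bar x):=\{d\in\mathcal L_X(\bar x):\nabla f(\bar x)\cdot d\le0\}$$ be the linearization cone and the critical cone. MPDC-LICQ is said to hold at $\bar x$ if $$\nabla F(\bar x)^\top\lambda=0,\quad \lambda\in\sum_{i\in I(\bar x)}\operatorname{span}\widehat{\mathcal N}_{D_i}(F(\bar x))\quad\Longrightarrow\quad\lambda=0.$$ **Theorem.** Let $\bar x\in X$ be a local minimizer of (MPDC) at which MPDC-LICQ holds. Then $S(\bar x)$ consists of exactly one multiplier $\bar\lambda$, and $$d^\top\nabla^2_{xx}L(\bar x,\bar\lambda)\,d\ \ge\ 0\qquad\text{for all } d\in\mathcal C_X(\bar x).$$ -/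

import Mathlib

open Filter Topology

noncomputable section

namespace Disjunctive

/-- `ℝⁿ` with the Euclidean inner product and norm. -/
abbrev Eucl (n : ℕ) : Type := EuclideanSpace ℝ (Fin n)

/-- A set is polyhedral if it is the intersection of finitely many closed half spaces
`{y | a · y ≤ b}`. -/
def IsPolyhedral {n : ℕ} (Q : Set (Eucl n)) : Prop :=
  ∃ (N : ℕ) (a : Fin N → Eucl n) (b : Fin N → ℝ), Q = {y | ∀ j, inner ℝ (a j) y ≤ b j}

/-- The (Bouligand) tangent cone to `A` at `x`; it is empty if `x ∉ A`. -/
def tangentCone {n : ℕ} (A : Set (Eucl n)) (x : Eucl n) : Set (Eucl n) :=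
  {d | x ∈ A ∧ ∃ (t : ℕ → ℝ) (e : ℕ → Eucl n),
    (∀ k, 0 < t k) ∧ Tendsto t atTop (𝓝 0) ∧ Tendsto e atTop (𝓝 d) ∧
      ∀ k, x + t k • e k ∈ A}

/-- The polar cone of a set. -/
def polarCone {n : ℕ} (A : Set (Eucl n)) : Set (Eucl n) :=
  {y | ∀ x ∈ A, inner ℝ x y ≤ 0}

/-- The Fréchet (regular) normal cone to `A` at `x`: the polar of the tangent cone if `x ∈ A`,
and empty if `x ∉ A`. -/
def frechetNormalCone {n : ℕ} (A : Set (Eucl n)) (x : Eucl n) : Set (Eucl n) :=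
  {y | x ∈ A ∧ y ∈ polarCone (tangentCone A x)}

/-- The Hessian of `φ` at `x` as a bilinear form: `hessian φ x d h = dᵀ ∇²φ(x) h`. -/
def hessian {n : ℕ} (φ : Eucl n → ℝ) (x : Eucl n) : Eucl n →L[ℝ] Eucl n →L[ℝ] ℝ :=
  fderiv ℝ (fderiv ℝ φ) x

/-- A mathematical program with disjunctive constraints: minimize `f x` subject to
`F x ∈ D₁ ∪ ⋯ ∪ Dᵣ`, where `f : ℝⁿ → ℝ` and `F : ℝⁿ → ℝᵐ` are twice continuously differentiable
and `D₁, …, Dᵣ ⊆ ℝᵐ` are polyhedral. -/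
structure MPDC (n m r : ℕ) where
  f : Eucl n → ℝ
  F : Eucl n → Eucl m
  D : Fin r → Set (Eucl m)
  contDiff_f : ContDiff ℝ 2 f
  contDiff_F : ContDiff ℝ 2 F
  polyhedral_D : ∀ i, IsPolyhedral (D i)

namespace MPDC

variable {n m r : ℕ} (P : MPDC n m r)

/-- The union `D` of the sets `Dᵢ`. -/
def disjunctiveSet : Set (Eucl m) := ⋃ i, P.D i

/-- The feasible set `X`. -/
def feasibleSet : Set (Eucl n) := {x | P.F x ∈ P.disjunctiveSet}

/-- `x` is a locally optimal solution (local minimizer). -/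
def IsLocallyOptimal (x : Eucl n) : Prop :=
  x ∈ P.feasibleSet ∧ IsLocalMinOn P.f P.feasibleSet x

/-- The index set `I(x)` of those `i` with `F x ∈ Dᵢ`. -/
def activeIndices (x : Eucl n) : Set (Fin r) := {i | P.F x ∈ P.D i}

/-- The Jacobian `∇F(x)`, as a linear map. -/
def jacobian (x : Eucl n) : Eucl n →L[ℝ] Eucl m := fderiv ℝ P.F x

/-- MPDC-LICQ at `x`: the only `lam` in the sum, over `i ∈ I(x)`, of the spans of the Fréchet
normal cones to `Dᵢ` at `F x` with `∇F(x)ᵀ lam = 0` is `lam = 0`. -/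
def LICQ (x : Eucl n) : Prop :=
  ∀ lam : Eucl m, ContinuousLinearMap.adjoint (P.jacobian x) lam = 0 →
    lam ∈ (⨆ i ∈ P.activeIndices x,
      Submodule.span ℝ (frechetNormalCone (P.D i) (P.F x)) : Submodule ℝ (Eucl m)) →
    lam = 0

/-- The Lagrangian `L(x, lam) = f(x) + F(x) · lam`. -/
def lagrangian (x : Eucl n) (lam : Eucl m) : ℝ := P.f x + inner ℝ (P.F x) lam

/-- The set `S(x)` of multipliers that solve the system of strong stationarity at `x`. -/
def multipliers (x : Eucl n) : Set (Eucl m) :=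
  {lam | lam ∈ (⋂ i ∈ P.activeIndices x, frechetNormalCone (P.D i) (P.F x)) ∧
    gradient (fun z => P.lagrangian z lam) x = 0}

/-- The linearization cone to `X` at `x`. -/
def linearizationCone (x : Eucl n) : Set (Eucl n) :=
  {d | P.jacobian x d ∈ tangentCone P.disjunctiveSet (P.F x)}

/-- The critical cone to `X` at `x`. -/
def criticalCone (x : Eucl n) : Set (Eucl n) :=
  {d | d ∈ P.linearizationCone x ∧ inner ℝ (gradient P.f x) d ≤ 0}

end MPDC

end Disjunctive

end

/-!
Let `W` be the sum of the spans of the active normal cones. MPDC-LICQ says that `∇F(x)ᵀ` is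
injective on `W`, so the orthogonal projection onto `W` of `F` is a submersion at `x`, and by the
implicit function theorem every direction `d` is the velocity of an arc along which this projection
is affine. The normals of the constraints active in some `Dᵢ` lie in `W`, so each such constraint is
an affine function of the arc parameter; hence the arc is feasible as soon as `d` belongs to the
linearization cone. Minimality of `f` along these arcs at first order produces the multiplier `λ`.
At second order, `λ ∈ W` and complementarity make `F · λ` constant along the arc of a critical
direction, so there the Lagrangian, whose gradient vanishes, is minimal too.
-/

open Asymptotics

namespace Disjunctive

section Calculus

variable {E V : Type*} [NormedAddCommGroup E] [NormedAddCommGroup V]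

theorem isLittleO_sub_second_order_taylor [NormedSpace ℝ E] [NormedSpace ℝ V] {φ : E → V}
    {φ' : E → E →L[ℝ] V} {φ'' : E →L[ℝ] E →L[ℝ] V} {x : E}
    (hφ : ∀ᶠ y in 𝓝 x, HasFDerivAt φ (φ' y) y) (hφ' : HasFDerivAt φ' φ'' x) :
    (fun y ↦ φ y - (φ x + φ' x (y - x) + (1 / 2 : ℝ) • φ'' (y - x) (y - x)))
      =o[𝓝 x] fun y ↦ ‖y - x‖ ^ 2 := by
  have hsymm := second_derivative_symmetric_of_eventually hφ hφ'
  obtain ⟨δ, hδ, hball⟩ := Metric.eventually_nhds_iff_ball.1 hφ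
  have hderiv : ∀ y ∈ Metric.ball x δ,
      HasFDerivAt (fun y ↦ φ y - (φ' x (y - x) + (1 / 2 : ℝ) • φ'' (y - x) (y - x)))
        (φ' y - φ' x - φ'' (y - x)) y := by
    intro y hy
    have hsub : HasFDerivAt (fun y ↦ y - x) (.id ℝ E) y := (hasFDerivAt_id y).sub_const x
    have hquad : HasFDerivAt (fun y ↦ (1 / 2 : ℝ) • φ'' (y - x) (y - x)) (φ'' (y - x)) y := by
      refine ((φ''.hasFDerivAt_of_bilinear hsub hsub).const_smul (1 / 2 : ℝ)).congr_fderiv ?_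
      ext u
      simp [hsymm u y, hsymm u x, ← two_smul ℝ, smul_smul]
    refine ((hball y hy).sub (((φ' x).hasFDerivAt.comp y hsub).add hquad)).congr_fderiv ?_
    rw [ContinuousLinearMap.comp_id, sub_add_eq_sub_sub]
  have hlittle := (convex_ball x δ).isLittleO_pow_succ (n := 1) (Metric.mem_ball_self hδ)
    (fun y hy ↦ (hderiv y hy).hasFDerivWithinAt)
    (by simpa using hφ'.isLittleO.norm_right.mono nhdsWithin_le_nhds)
  rw [nhdsWithin_eq_nhds.2 (Metric.ball_mem_nhds x hδ)] at hlittle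
  refine hlittle.congr_left fun y ↦ ?_
  simp only [sub_self, map_zero, smul_zero, add_zero, sub_zero]
  abel

/-- The arc is `x + t • d + R (u t)`, with `R` a right inverse of `G'` and `u` given by the implicit
function theorem applied to `(t, u) ↦ G (x + t • d + R u) - t • G' d`. -/
theorem exists_hasDerivAt_eq_add_smul_of_hasRightInverse {𝕜 : Type*} [NontriviallyNormedField 𝕜]
    [CompleteSpace 𝕜] [NormedSpace 𝕜 E] [NormedSpace 𝕜 V] [CompleteSpace V] {G : E → V}
    {G' : E →L[𝕜] V} {x : E} (hG : HasStrictFDerivAt G G' x) (hG' : G'.HasRightInverse) (d : E) :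
    ∃ c : 𝕜 → E, c 0 = x ∧ HasDerivAt c d 0 ∧ ∀ᶠ t in 𝓝 0, G (c t) = G x + t • G' d := by
  obtain ⟨R, hR⟩ := hG'
  let lift : 𝕜 × V →L[𝕜] E := (ContinuousLinearMap.toSpanSingleton 𝕜 d).coprod R
  let shift : 𝕜 × V →L[𝕜] V :=
    ContinuousLinearMap.toSpanSingleton 𝕜 (G' d) ∘L ContinuousLinearMap.fst 𝕜 𝕜 V
  let g : 𝕜 × V → V := fun p ↦ G (x + lift p) - shift p
  have hg' : HasStrictFDerivAt g (ContinuousLinearMap.snd 𝕜 𝕜 V) 0 := by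
    have hinner : HasStrictFDerivAt (fun p ↦ x + lift p) lift 0 :=
      lift.hasStrictFDerivAt.const_add x
    have hG₀ : HasStrictFDerivAt G G' (x + lift 0) := by simpa using hG
    refine ((hG₀.comp 0 hinner).sub shift.hasStrictFDerivAt).congr_fderiv ?_
    ext p <;> simp [lift, shift, hR _]
  have hinv : (ContinuousLinearMap.snd 𝕜 𝕜 V ∘L .inr 𝕜 𝕜 V).IsInvertible :=
    ⟨.refl 𝕜 V, by ext; simp⟩
  obtain ⟨u, hu₀, hu, hgu⟩ :
      ∃ u : 𝕜 → V, u 0 = 0 ∧ HasDerivAt u 0 0 ∧ ∀ᶠ t in 𝓝 0, g (t, u t) = g 0 :=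
    ⟨hg'.implicitFunctionOfProdDomain hinv,
      (hg'.eventually_apply_eq_iff_implicitFunctionOfProdDomain hinv).self_of_nhds.1 rfl,
      by simpa using
        (hg'.hasStrictFDerivAt_implicitFunctionOfProdDomain hinv).hasFDerivAt.hasDerivAt,
      hg'.eventually_apply_implicitFunctionOfProdDomain hinv⟩
  refine ⟨fun t ↦ x + lift (t, u t), by simp [lift, hu₀], ?_, ?_⟩
  · simpa [lift] using
      (lift.hasFDerivAt.comp_hasDerivAt (0 : 𝕜) ((hasDerivAt_id 0).prodMk hu)).const_add x
  · filter_upwards [hgu] with t ht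
    have ht' : G (x + lift (t, u t)) - t • G' d = G x := by simpa [g, shift] using ht
    rw [← ht', sub_add_cancel]

variable [NormedSpace ℝ E] {φ : E → ℝ} {c : ℝ → E} {d : E}

theorem fderiv_apply_nonneg_of_isLocalMinOn_comp (hφ : DifferentiableAt ℝ φ (c 0))
    (hc : HasDerivWithinAt c d (Set.Ioi 0) 0) (hmin : IsLocalMinOn (φ ∘ c) (Set.Ioi 0) 0) :
    0 ≤ fderiv ℝ φ (c 0) d := by
  have hcomp := hφ.hasFDerivAt.comp_hasDerivWithinAt (0 : ℝ) hc
  have hone : (1 : ℝ) ∈ posTangentConeAt (Set.Ioi 0) (0 : ℝ) :=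
    one_mem_posTangentConeAt_iff_frequently.2 (eventually_mem_nhdsWithin.frequently)
  simpa using hmin.hasFDerivWithinAt_nonneg hcomp.hasFDerivWithinAt hone

theorem tendsto_div_sq_of_fderiv_eq_zero (hφ : ContDiffAt ℝ 2 φ (c 0))
    (hcrit : fderiv ℝ φ (c 0) = 0) (hc : HasDerivWithinAt c d (Set.Ioi 0) 0) :
    Tendsto (fun t ↦ (φ (c t) - φ (c 0)) / t ^ 2) (𝓝[>] 0)
      (𝓝 (1 / 2 * fderiv ℝ (fderiv ℝ φ) (c 0) d d)) := by
  set H := fderiv ℝ (fderiv ℝ φ) (c 0)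
  have hH : HasFDerivAt (fderiv ℝ φ) H (c 0) :=
    ((hφ.fderiv_right (m := 1) (by norm_num)).differentiableAt (by norm_num)).hasFDerivAt
  have hdiff : ∀ᶠ y in 𝓝 (c 0), HasFDerivAt φ (fderiv ℝ φ y) y :=
    (hφ.eventually (by simp)).mono fun y hy ↦ (hy.differentiableAt (by norm_num)).hasFDerivAt
  have hslope : Tendsto (fun t ↦ t⁻¹ • (c t - c 0)) (𝓝[>] 0) (𝓝 d) := by
    simpa [slope_fun_def] using (hasDerivWithinAt_iff_tendsto_slope' Set.self_notMem_Ioi).1 hc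
  have hremainder : (fun t ↦ φ (c t) - φ (c 0) - 1 / 2 * H (c t - c 0) (c t - c 0))
      =o[𝓝[>] 0] fun t : ℝ ↦ t ^ 2 := by
    have hbigO : (fun t ↦ ‖c t - c 0‖ ^ 2) =O[𝓝[>] 0] fun t ↦ t ^ 2 := by
      simpa using hc.hasFDerivWithinAt.isBigO_sub.norm_left.pow 2
    simpa [hcrit, Function.comp_def, sub_sub] using
      ((isLittleO_sub_second_order_taylor hdiff hH).comp_tendsto
        hc.continuousWithinAt).trans_isBigO hbigO
  have hquad : Tendsto (fun t ↦ 1 / 2 * H (t⁻¹ • (c t - c 0)) (t⁻¹ • (c t - c 0))) (𝓝[>] 0)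
      (𝓝 (1 / 2 * H d d)) :=
    ((by fun_prop : Continuous fun v ↦ 1 / 2 * H v v).tendsto d).comp hslope
  have hsum := hremainder.tendsto_div_nhds_zero.add hquad
  rw [zero_add] at hsum
  refine hsum.congr fun t ↦ ?_
  simp only [map_smul, smul_apply, smul_eq_mul]
  ring

theorem fderiv_fderiv_apply_nonneg_of_isLocalMinOn_comp (hφ : ContDiffAt ℝ 2 φ (c 0))
    (hcrit : fderiv ℝ φ (c 0) = 0) (hc : HasDerivWithinAt c d (Set.Ioi 0) 0)
    (hmin : IsLocalMinOn (φ ∘ c) (Set.Ioi 0) 0) :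
    0 ≤ fderiv ℝ (fderiv ℝ φ) (c 0) d d := by
  have hlim := ge_of_tendsto (tendsto_div_sq_of_fderiv_eq_zero hφ hcrit hc)
    (hmin.mono fun t ht ↦ div_nonneg (sub_nonneg.2 ht) (sq_nonneg t))
  linarith

end Calculus

theorem surjective_orthogonalProjectionOnto_comp {𝕜 E F : Type*} [RCLike 𝕜]
    [NormedAddCommGroup E] [InnerProductSpace 𝕜 E] [CompleteSpace E] [NormedAddCommGroup F]
    [InnerProductSpace 𝕜 F] [CompleteSpace F] (A : E →L[𝕜] F) (W : Submodule 𝕜 F)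
    [FiniteDimensional 𝕜 W] (hinj : ∀ w ∈ W, A.adjoint w = 0 → w = 0) :
    Function.Surjective (W.orthogonalProjectionOnto ∘L A) := by
  rw [← ContinuousLinearMap.coe_coe, ← LinearMap.range_eq_top, ← Submodule.orthogonal_eq_bot_iff,
    ContinuousLinearMap.orthogonal_range, Submodule.eq_bot_iff]
  intro w hw
  refine Subtype.ext (hinj w w.2 ?_)
  simpa [ContinuousLinearMap.adjoint_comp, W.adjoint_orthogonalProjectionOnto] using hw

section TangentCone

variable {n : ℕ} {A B : Set (Eucl n)} {x v : Eucl n}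

theorem tangentCone_mono (hAB : A ⊆ B) (x : Eucl n) : tangentCone A x ⊆ tangentCone B x :=
  fun _ ⟨hx, t, e, ht, ht₀, he, hmem⟩ ↦ ⟨hAB hx, t, e, ht, ht₀, he, fun k ↦ hAB (hmem k)⟩

theorem smul_mem_tangentCone {s : ℝ} (hs : 0 < s) (hv : v ∈ tangentCone A x) :
    s • v ∈ tangentCone A x := by
  obtain ⟨hx, t, e, ht, ht₀, he, hmem⟩ := hv
  refine ⟨hx, fun k ↦ t k / s, fun k ↦ s • e k, fun k ↦ div_pos (ht k) hs,
    by simpa using ht₀.div_const s, he.const_smul s, fun k ↦ ?_⟩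
  rw [smul_smul, div_mul_cancel₀ _ hs.ne']
  exact hmem k

theorem mem_tangentCone_of_frequently_mem (hx : x ∈ A)
    (h : ∃ᶠ t in 𝓝[>] (0 : ℝ), x + t • v ∈ A) : v ∈ tangentCone A x := by
  obtain ⟨t, ht, hmem⟩ := exists_seq_forall_of_frequently
    (h.and_eventually eventually_mem_nhdsWithin)
  exact ⟨hx, t, fun _ ↦ v, fun k ↦ (hmem k).2, ht.mono_right nhdsWithin_le_nhds,
    tendsto_const_nhds, fun k ↦ (hmem k).1⟩

theorem zero_mem_tangentCone (hx : x ∈ A) : 0 ∈ tangentCone A x :=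
  mem_tangentCone_of_frequently_mem hx <| Eventually.frequently <| .of_forall fun t ↦ by simpa

theorem tangentCone_iUnion {ι : Type*} [Finite ι] {D : ι → Set (Eucl n)}
    (hD : ∀ i, IsClosed (D i)) (x : Eucl n) :
    tangentCone (⋃ i, D i) x = ⋃ i, tangentCone (D i) x := by
  refine Set.Subset.antisymm ?_
    (Set.iUnion_subset fun i ↦ tangentCone_mono (Set.subset_iUnion D i) x)
  rintro v ⟨-, t, e, ht, ht₀, he, hmem⟩
  obtain ⟨i, hi⟩ : ∃ i, ∃ᶠ k in atTop, x + t k • e k ∈ D i :=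
    frequently_exists.1 (Frequently.of_forall fun k ↦ Set.mem_iUnion.1 (hmem k))
  obtain ⟨κ, hκ, hκmem⟩ := extraction_of_frequently_atTop hi
  have hlim : Tendsto (fun k ↦ x + t k • e k) atTop (𝓝 x) := by
    simpa using tendsto_const_nhds.add (ht₀.smul he)
  exact Set.mem_iUnion.2 ⟨i, (hD i).mem_of_frequently_of_tendsto hi hlim, t ∘ κ, e ∘ κ,
    fun k ↦ ht (κ k), ht₀.comp hκ.tendsto_atTop, he.comp hκ.tendsto_atTop, hκmem⟩

end TangentCone

section Polyhedra

variable {n : ℕ} {ι : Type*} {a : ι → Eucl n} {b : ι → ℝ} {Q : Set (Eucl n)} {y v : Eucl n}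

/-- The polyhedron cut out by the half spaces `a j · z ≤ b j`: the explicit form of a polyhedral
set, for which the constraints active at a point can be named. -/
def polyhedron (a : ι → Eucl n) (b : ι → ℝ) : Set (Eucl n) := {z | ∀ j, inner ℝ (a j) z ≤ b j}

theorem isClosed_polyhedron (a : ι → Eucl n) (b : ι → ℝ) : IsClosed (polyhedron a b) := by
  simp only [polyhedron, Set.ofPred_forall]
  exact isClosed_iInter fun j ↦ isClosed_le (by fun_prop) continuous_const

theorem eventually_mem_polyhedron [Finite ι] (hy : y ∈ polyhedron a b) :
    ∀ᶠ z in 𝓝 y, (∀ j, inner ℝ (a j) y = b j → inner ℝ (a j) (z - y) ≤ 0) →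
      z ∈ polyhedron a b := by
  have hinactive : ∀ᶠ z in 𝓝 y, ∀ j, inner ℝ (a j) y < b j → inner ℝ (a j) z < b j :=
    eventually_all.2 fun j ↦ eventually_imp_distrib_left.2 fun hj ↦
      (by fun_prop : Continuous fun z ↦ inner ℝ (a j) z).continuousAt.eventually_lt_const hj
  filter_upwards [hinactive] with z hz hactive j
  obtain hj | hj := (hy j).lt_or_eq
  · exact (hz j hj).le
  · simpa [inner_sub_right, hj] using hactive j hj

theorem inner_nonpos_of_mem_tangentCone_polyhedron (hv : v ∈ tangentCone (polyhedron a b) y) {j : ι}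
    (hj : inner ℝ (a j) y = b j) : inner ℝ (a j) v ≤ 0 := by
  obtain ⟨-, t, e, ht, -, he, hmem⟩ := hv
  refine le_of_tendsto' (tendsto_const_nhds.inner he) fun k ↦ ?_
  have hk := hmem k j
  rw [inner_add_right, inner_smul_right, hj] at hk
  exact nonpos_of_mul_nonpos_right (by linarith) (ht k)

theorem mem_frechetNormalCone_polyhedron (hy : y ∈ polyhedron a b) {j : ι}
    (hj : inner ℝ (a j) y = b j) : a j ∈ frechetNormalCone (polyhedron a b) y :=
  ⟨hy, fun v hv ↦ by
    simpa only [real_inner_comm] using inner_nonpos_of_mem_tangentCone_polyhedron hv hj⟩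

theorem mem_tangentCone_polyhedron [Finite ι] (hy : y ∈ polyhedron a b)
    (hv : ∀ j, inner ℝ (a j) y = b j → inner ℝ (a j) v ≤ 0) :
    v ∈ tangentCone (polyhedron a b) y := by
  have hline : Tendsto (fun t : ℝ ↦ y + t • v) (𝓝[>] 0) (𝓝 y) :=
    Continuous.tendsto' (by fun_prop) 0 y (by simp) |>.mono_left nhdsWithin_le_nhds
  refine mem_tangentCone_of_frequently_mem hy (Eventually.frequently ?_)
  filter_upwards [hline.eventually (eventually_mem_polyhedron hy), eventually_mem_nhdsWithin]
    with t hmem ht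
  refine hmem fun j hj ↦ ?_
  rw [add_sub_cancel_left, inner_smul_right]
  exact mul_nonpos_of_nonneg_of_nonpos (le_of_lt ht) (hv j hj)

theorem IsPolyhedral.isClosed (hQ : IsPolyhedral Q) : IsClosed Q := by
  obtain ⟨N, a, b, rfl⟩ := hQ
  exact isClosed_polyhedron a b

theorem IsPolyhedral.mem_tangentCone_iff (hQ : IsPolyhedral Q) (hy : y ∈ Q) :
    v ∈ tangentCone Q y ↔ ∀ w ∈ frechetNormalCone Q y, inner ℝ w v ≤ 0 := by
  refine ⟨fun hv w hw ↦ by simpa only [real_inner_comm] using hw.2 v hv, fun h ↦ ?_⟩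
  obtain ⟨N, a, b, rfl⟩ := hQ
  exact mem_tangentCone_polyhedron hy fun j hj ↦ h _ (mem_frechetNormalCone_polyhedron hy hj)

theorem IsPolyhedral.eventually_mem_of_sub_mem_tangentCone (hQ : IsPolyhedral Q) (y : Eucl n) :
    ∀ᶠ z in 𝓝 y, z - y ∈ tangentCone Q y → z ∈ Q := by
  obtain ⟨N, a, b, rfl⟩ := hQ
  by_cases hy : y ∈ polyhedron a b
  · filter_upwards [eventually_mem_polyhedron hy] with z hz hzy
    exact hz fun j hj ↦ inner_nonpos_of_mem_tangentCone_polyhedron hzy hj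
  · exact .of_forall fun z hz ↦ absurd hz.1 hy

end Polyhedra

namespace MPDC

variable {n m r : ℕ} {P : MPDC n m r} {x d : Eucl n} {lam : Eucl m} {c : ℝ → Eucl n}

section DisjunctiveSet

theorem tangentCone_disjunctiveSet (P : MPDC n m r) (y : Eucl m) :
    tangentCone P.disjunctiveSet y = ⋃ i, tangentCone (P.D i) y :=
  tangentCone_iUnion (fun i ↦ (P.polyhedral_D i).isClosed) y

theorem eventually_mem_disjunctiveSet_of_sub_mem_tangentCone (P : MPDC n m r) (y : Eucl m) :
    ∀ᶠ z in 𝓝 y, z - y ∈ tangentCone P.disjunctiveSet y → z ∈ P.disjunctiveSet := by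
  filter_upwards [eventually_all.2 fun i ↦
    (P.polyhedral_D i).eventually_mem_of_sub_mem_tangentCone y] with z hz hzy
  rw [tangentCone_disjunctiveSet] at hzy
  obtain ⟨i, hi⟩ := Set.mem_iUnion.1 hzy
  exact Set.mem_iUnion.2 ⟨i, hz i hi⟩

theorem iInter_frechetNormalCone (P : MPDC n m r) (x : Eucl n) :
    ⋂ i ∈ P.activeIndices x, frechetNormalCone (P.D i) (P.F x) =
      polarCone (tangentCone P.disjunctiveSet (P.F x)) := by
  ext w
  simp only [tangentCone_disjunctiveSet, Set.mem_iInter, polarCone, Set.mem_iUnion,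
    Set.mem_ofPred_eq]
  exact ⟨fun h v ⟨i, hv⟩ ↦ (h i hv.1).2 v hv, fun h i hi ↦ ⟨hi, fun v hv ↦ h v ⟨i, hv⟩⟩⟩

/-- The sum of the spans of the normal cones to the active polyhedra, that is, the subspace on which
MPDC-LICQ requires `∇F(x)ᵀ` to be injective. -/
def normalSpan (P : MPDC n m r) (x : Eucl n) : Submodule ℝ (Eucl m) :=
  ⨆ i ∈ P.activeIndices x, Submodule.span ℝ (frechetNormalCone (P.D i) (P.F x))

theorem frechetNormalCone_subset_normalSpan {i : Fin r} (hi : i ∈ P.activeIndices x) :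
    frechetNormalCone (P.D i) (P.F x) ⊆ P.normalSpan x :=
  Submodule.span_le.1 <| le_iSup₂_of_le
    (f := fun i (_ : i ∈ P.activeIndices x) ↦
      Submodule.span ℝ (frechetNormalCone (P.D i) (P.F x))) i hi le_rfl

theorem mem_tangentCone_disjunctiveSet_of_inner_eq {u v : Eucl m}
    (hu : u ∈ tangentCone P.disjunctiveSet (P.F x))
    (huv : ∀ w ∈ P.normalSpan x, inner ℝ w v = inner ℝ w u) :
    v ∈ tangentCone P.disjunctiveSet (P.F x) := by
  rw [tangentCone_disjunctiveSet] at hu ⊢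
  obtain ⟨i, hi⟩ := Set.mem_iUnion.1 hu
  refine Set.mem_iUnion.2 ⟨i, ((P.polyhedral_D i).mem_tangentCone_iff hi.1).2 fun w hw ↦ ?_⟩
  rw [huv w (frechetNormalCone_subset_normalSpan hi.1 hw)]
  exact ((P.polyhedral_D i).mem_tangentCone_iff hi.1).1 hi w hw

theorem mem_normalSpan_of_mem_multipliers (hx : x ∈ P.feasibleSet) (hlam : lam ∈ P.multipliers x) :
    lam ∈ P.normalSpan x := by
  obtain ⟨i, hi⟩ := Set.mem_iUnion.1 hx
  exact frechetNormalCone_subset_normalSpan hi (Set.mem_iInter₂.1 hlam.1 i hi)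

end DisjunctiveSet

section Arcs

/-- A feasible arc `t ↦ c t`, `t ≥ 0`, issuing from `x` with velocity `d`, along which every
component of `F` in the normal span at `x` is an affine function of `t`. -/
structure IsFeasibleArc (P : MPDC n m r) (x d : Eucl n) (c : ℝ → Eucl n) : Prop where
  map_zero : c 0 = x
  hasDerivWithinAt : HasDerivWithinAt c d (Set.Ioi 0) 0
  eventually_mem : ∀ᶠ t in 𝓝[>] 0, c t ∈ P.feasibleSet
  inner_sub_eq : ∀ᶠ t in 𝓝[>] 0, ∀ w ∈ P.normalSpan x,
    inner ℝ w (P.F (c t) - P.F x) = t * inner ℝ w (P.jacobian x d)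

theorem hasStrictFDerivAt_F (P : MPDC n m r) (x : Eucl n) :
    HasStrictFDerivAt P.F (P.jacobian x) x :=
  P.contDiff_F.contDiffAt.hasStrictFDerivAt (by norm_num)

theorem LICQ.surjective_orthogonalProjectionOnto_comp_jacobian (hlicq : P.LICQ x) :
    Function.Surjective ((P.normalSpan x).orthogonalProjectionOnto ∘L P.jacobian x) :=
  surjective_orthogonalProjectionOnto_comp _ _ fun w hw h ↦ hlicq w h hw

theorem LICQ.exists_inner_jacobian_eq (hlicq : P.LICQ x) (v : Eucl m) :
    ∃ d, ∀ w ∈ P.normalSpan x, inner ℝ w (P.jacobian x d) = inner ℝ w v := by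
  obtain ⟨d, hd⟩ := hlicq.surjective_orthogonalProjectionOnto_comp_jacobian
    ((P.normalSpan x).orthogonalProjectionOnto v)
  refine ⟨d, fun w hw ↦ ?_⟩
  simpa using congrArg (inner ℝ (⟨w, hw⟩ : P.normalSpan x)) hd

theorem LICQ.exists_isFeasibleArc (hlicq : P.LICQ x) (hd : d ∈ P.linearizationCone x) :
    ∃ c, P.IsFeasibleArc x d c := by
  set π := (P.normalSpan x).orthogonalProjectionOnto
  obtain ⟨c, hc₀, hc, heq⟩ := exists_hasDerivAt_eq_add_smul_of_hasRightInverse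
    (π.hasStrictFDerivAt.comp x (P.hasStrictFDerivAt_F x))
    (.of_surjective_of_finiteDimensional
      hlicq.surjective_orthogonalProjectionOnto_comp_jacobian) d
  have hinner : ∀ᶠ t in 𝓝[>] 0, ∀ w ∈ P.normalSpan x,
      inner ℝ w (P.F (c t) - P.F x) = t * inner ℝ w (P.jacobian x d) := by
    filter_upwards [nhdsWithin_le_nhds heq] with t ht w hw
    rw [inner_sub_right, sub_eq_iff_eq_add']
    simpa [π, inner_add_right, inner_smul_right] using
      congrArg (inner ℝ (⟨w, hw⟩ : P.normalSpan x)) ht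
  have hlim : Tendsto (P.F ∘ c) (𝓝[>] 0) (𝓝 (P.F x)) := by
    have hcont := P.contDiff_F.continuous.continuousAt.comp hc.continuousAt
    simpa only [ContinuousAt, Function.comp_apply, hc₀] using hcont.mono_left nhdsWithin_le_nhds
  refine ⟨c, hc₀, hc.hasDerivWithinAt, ?_, hinner⟩
  filter_upwards [hinner, eventually_mem_nhdsWithin,
    hlim.eventually (P.eventually_mem_disjunctiveSet_of_sub_mem_tangentCone (P.F x))]
    with t hct ht hmem
  refine hmem <| mem_tangentCone_disjunctiveSet_of_inner_eq (smul_mem_tangentCone ht hd)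
    fun w hw ↦ ?_
  rw [inner_smul_right]
  exact hct w hw

theorem IsFeasibleArc.isLocalMinOn_comp (hc : P.IsFeasibleArc x d c)
    (hopt : P.IsLocallyOptimal x) : IsLocalMinOn (P.f ∘ c) (Set.Ioi 0) 0 := by
  obtain ⟨rfl, hd, hmem, -⟩ := hc
  exact IsMinFilter.comp_tendsto hopt.2
    (tendsto_nhdsWithin_iff.2 ⟨hd.continuousWithinAt, hmem⟩)

end Arcs

section Stationarity

theorem IsLocallyOptimal.inner_gradient_nonneg (hopt : P.IsLocallyOptimal x) (hlicq : P.LICQ x)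
    (hd : d ∈ P.linearizationCone x) : 0 ≤ inner ℝ (gradient P.f x) d := by
  obtain ⟨c, hc⟩ := hlicq.exists_isFeasibleArc hd
  have hmin := hc.isLocalMinOn_comp hopt
  obtain ⟨rfl, hcd, -, -⟩ := hc
  rw [inner_gradient_left]
  exact fderiv_apply_nonneg_of_isLocalMinOn_comp
    (P.contDiff_f.differentiable (by norm_num) _) hcd hmin

theorem contDiff_lagrangian (P : MPDC n m r) (lam : Eucl m) :
    ContDiff ℝ 2 fun z ↦ P.lagrangian z lam :=
  P.contDiff_f.add (P.contDiff_F.inner ℝ contDiff_const)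

theorem gradient_lagrangian (P : MPDC n m r) (x : Eucl n) (lam : Eucl m) :
    gradient (fun z ↦ P.lagrangian z lam) x = gradient P.f x + (P.jacobian x).adjoint lam := by
  have hf : HasFDerivAt P.f (fderiv ℝ P.f x) x :=
    (P.contDiff_f.differentiable (by norm_num) x).hasFDerivAt
  have hL : HasFDerivAt (fun z ↦ P.lagrangian z lam) _ x :=
    hf.add ((P.hasStrictFDerivAt_F x).hasFDerivAt.inner ℝ (hasFDerivAt_const lam x))
  refine ext_inner_right ℝ fun d ↦ ?_
  rw [inner_gradient_left, inner_add_left, inner_gradient_left,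
    ContinuousLinearMap.adjoint_inner_left, hL.fderiv]
  simp [real_inner_comm]

theorem IsLocallyOptimal.exists_adjoint_jacobian_eq_neg_gradient (hopt : P.IsLocallyOptimal x)
    (hlicq : P.LICQ x) :
    ∃ lam ∈ P.normalSpan x, (P.jacobian x).adjoint lam = -gradient P.f x := by
  set K := (P.normalSpan x).map (P.jacobian x).adjoint.toLinearMap
  suffices hortho : -gradient P.f x ∈ Kᗮᗮ by
    rw [Submodule.orthogonal_orthogonal] at hortho
    exact Submodule.mem_map.1 hortho
  have hlin : ∀ d ∈ Kᗮ, d ∈ P.linearizationCone x := fun d hd ↦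
    mem_tangentCone_disjunctiveSet_of_inner_eq (zero_mem_tangentCone hopt.1) fun w hw ↦ by
      rw [← ContinuousLinearMap.adjoint_inner_left, inner_zero_right]
      exact (Submodule.mem_orthogonal K d).1 hd _ (Submodule.mem_map_of_mem hw)
  refine neg_mem ((Submodule.mem_orthogonal' _ _).2 fun d hd ↦ ?_)
  have hpos := hopt.inner_gradient_nonneg hlicq (hlin d hd)
  have hneg := hopt.inner_gradient_nonneg hlicq (hlin (-d) (neg_mem hd))
  rw [inner_neg_right] at hneg
  linarith

theorem IsLocallyOptimal.nonempty_multipliers (hopt : P.IsLocallyOptimal x) (hlicq : P.LICQ x) :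
    (P.multipliers x).Nonempty := by
  obtain ⟨lam, hlam, hgrad⟩ := hopt.exists_adjoint_jacobian_eq_neg_gradient hlicq
  refine ⟨lam, ?_, by rw [gradient_lagrangian, hgrad, add_neg_cancel]⟩
  rw [iInter_frechetNormalCone]
  intro v hv
  obtain ⟨d, hd⟩ := hlicq.exists_inner_jacobian_eq v
  have hpos := hopt.inner_gradient_nonneg hlicq
    (mem_tangentCone_disjunctiveSet_of_inner_eq hv hd : d ∈ P.linearizationCone x)
  have hpair : inner ℝ lam v = -inner ℝ (gradient P.f x) d := by
    rw [← hd lam hlam, ← ContinuousLinearMap.adjoint_inner_left, hgrad, inner_neg_left]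
  rw [real_inner_comm, hpair]
  linarith

theorem LICQ.multipliers_subsingleton (hlicq : P.LICQ x) (hx : x ∈ P.feasibleSet) :
    (P.multipliers x).Subsingleton := by
  intro lam hlam mu hmu
  refine sub_eq_zero.1 (hlicq _ ?_ (sub_mem (mem_normalSpan_of_mem_multipliers hx hlam)
    (mem_normalSpan_of_mem_multipliers hx hmu)))
  rw [map_sub, sub_eq_zero]
  refine add_left_cancel (a := gradient P.f x) ?_
  rw [← gradient_lagrangian, ← gradient_lagrangian, hlam.2, hmu.2]

theorem inner_jacobian_eq_zero_of_mem_criticalCone (hlam : lam ∈ P.multipliers x)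
    (hd : d ∈ P.criticalCone x) : inner ℝ lam (P.jacobian x d) = 0 := by
  obtain ⟨hnormal, hgrad⟩ := hlam
  rw [iInter_frechetNormalCone] at hnormal
  have hnonpos : inner ℝ lam (P.jacobian x d) ≤ 0 := by
    simpa only [real_inner_comm] using hnormal _ hd.1
  have hsum : inner ℝ (gradient P.f x) d + inner ℝ lam (P.jacobian x d) = 0 := by
    rw [← ContinuousLinearMap.adjoint_inner_left, ← inner_add_left, ← gradient_lagrangian, hgrad,
      inner_zero_left]
  linarith [hd.2]

theorem IsFeasibleArc.isLocalMinOn_lagrangian_comp (hc : P.IsFeasibleArc x d c)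
    (hopt : P.IsLocallyOptimal x) (hlam : lam ∈ P.multipliers x) (hd : d ∈ P.criticalCone x) :
    IsLocalMinOn ((fun z ↦ P.lagrangian z lam) ∘ c) (Set.Ioi 0) 0 := by
  filter_upwards [hc.isLocalMinOn_comp hopt, hc.inner_sub_eq] with t hle hpair
  have hconst := hpair lam (mem_normalSpan_of_mem_multipliers hopt.1 hlam)
  rw [inner_jacobian_eq_zero_of_mem_criticalCone hlam hd, mul_zero, inner_sub_right,
    sub_eq_zero] at hconst
  simp only [Function.comp_apply, lagrangian, real_inner_comm lam, hc.map_zero, hconst] at hle ⊢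
  gcongr

theorem IsLocallyOptimal.hessian_lagrangian_nonneg (hopt : P.IsLocallyOptimal x)
    (hlicq : P.LICQ x) (hlam : lam ∈ P.multipliers x) (hd : d ∈ P.criticalCone x) :
    0 ≤ hessian (fun z ↦ P.lagrangian z lam) x d d := by
  obtain ⟨c, hc⟩ := hlicq.exists_isFeasibleArc hd.1
  have hmin := hc.isLocalMinOn_lagrangian_comp hopt hlam hd
  have hcrit : fderiv ℝ (fun z ↦ P.lagrangian z lam) x = 0 := by
    rw [← toDual_gradient, hlam.2, map_zero]
  obtain ⟨rfl, hcd, -, -⟩ := hc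
  exact fderiv_fderiv_apply_nonneg_of_isLocalMinOn_comp (P.contDiff_lagrangian lam).contDiffAt
    hcrit hcd hmin

end Stationarity

end MPDC

end Disjunctive

theorem mainTheorem2 {n m r : ℕ} (P : Disjunctive.MPDC n m r)
    (xbar : Disjunctive.Eucl n) (hopt : P.IsLocallyOptimal xbar) (hlicq : P.LICQ xbar) :
    ∃ lambar : Disjunctive.Eucl m, P.multipliers xbar = {lambar} ∧
      ∀ d ∈ P.criticalCone xbar,
        0 ≤ Disjunctive.hessian (fun x => P.lagrangian x lambar) xbar d d := by
  obtain ⟨lambar, hmult⟩ := Set.exists_eq_singleton_iff_nonempty_subsingleton.2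
    ⟨hopt.nonempty_multipliers hlicq, hlicq.multipliers_subsingleton hopt.1⟩
  exact ⟨lambar, hmult, fun d hd ↦ hopt.hessian_lagrangian_nonneg hlicq (by simp [hmult]) hd⟩
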